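/- Let $n,k$ be positive integers, let $\vec s=(s_1,\dots,s_k)$ be a vector of positive integers, and let $[n]=\{1,\dots,n\}$. A $k$-element subset $A=\{A(1)<\dots<A(k)\}$ of $[n]$ is called $\vec s$-stable if $s_j\le A(j+1)-A(j)$ for $1\le j\le k-1$ and $A(k)-A(1)\le n-s_k$. Let $KG(n,k)_{\vec s\text{-stab}}$ be the graph whose vertices are the $\vec s$-stable $k$-subsets of $[n]$, two of them being adjacent if and only if they are disjoint. For a graph $G$, let $\mathcal N(G)$ be its neighborhood complex, the simplicial complex whose simplices are the nonempty sets of vertices of $G$ that have a common neighbor. Let $P(n,k,\vec s)$ be the poset of all ordered pairs $(A,B)$ of disjoint subsets of $[n]$ such that each of $A$ and $B$ contains an $\vec s$-stable $k$-subset, ordered by $(A_1,B_1)\le(A_2,B_2)$ if and only if $A_1\subseteq A_2$ and $B_1\subseteq B_2$, and let $\Delta(P(n,k,\vec s))$ be its order complex, whose simplices are the nonempty finite chains. Then (the geometric realizations of) $\mathcal N\left(KG(n,k)_{\vec s\text{-stab}}\right)$ and $\Delta\left(P(n,k,\vec s)\right)$ are homotopy equivalent: $$\mathcal N\left(KG(n,k)_{\vec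 s\text{-stab}}\right)\simeq\Delta\left(P(n,k,\vec s)\right).$$ -/

import Mathlib

noncomputable section

/-- The geometric realization of an abstract simplicial complex on a finite type of (potential)
vertices: the points of `ι → ℝ` given by barycentric coordinates on some face. -/
def geomRealization {ι : Type*} [Finite ι] (K : PreAbstractSimplicialComplex ι) : Set (ι → ℝ) :=
  {w | (∀ i, 0 ≤ w i) ∧ ∃ σ ∈ K.faces, (∀ i, i ∉ σ → w i = 0) ∧ ∑ i ∈ σ, w i = 1}

/-- The neighborhood complex of a graph: the nonempty finite sets of vertices which have a common
neighbor. -/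
def neighborhoodComplex {V : Type*} (G : SimpleGraph V) : PreAbstractSimplicialComplex V where
  faces := {σ | σ.Nonempty ∧ ∃ v, ∀ u ∈ σ, G.Adj v u}
  isRelLowerSet_faces := fun _ hσ =>
    ⟨hσ.1, fun _ hτ hne => ⟨hne, hσ.2.imp fun _ hv u hu => hv u (hτ hu)⟩⟩

/-- The order complex of a poset: the nonempty finite chains. -/
def orderComplex (P : Type*) [PartialOrder P] : PreAbstractSimplicialComplex P where
  faces := {σ | σ.Nonempty ∧ IsChain (· ≤ ·) (σ : Set P)}
  isRelLowerSet_faces := fun _ hσ =>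
    ⟨hσ.1, fun _ hτ hne => ⟨hne, hσ.2.mono (Finset.coe_subset.mpr hτ)⟩⟩

/-- The Kneser graph on the `k`-subsets of an `n`-set; `A ≠ B` is automatic from disjointness
when `k` is positive. -/
def kneserGraph (n k : ℕ) : SimpleGraph {A : Finset (Fin n) // A.card = k} where
  Adj A B := A ≠ B ∧ Disjoint A.1 B.1
  symm := ⟨fun _ _ h => ⟨h.1.symm, h.2.symm⟩⟩
  loopless := ⟨fun _ h => h.1 rfl⟩

/-- `A` is an `s`-stable `k`-set. The ordered elements `A(1) < ⋯ < A(k)` of `A` are the values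
`a 0 < ⋯ < a (k - 1)` of the increasing enumeration `a`; the ground set `{1, …, n}` is modelled by
`Fin n`, and only differences of elements enter. -/
def IsStableSet {n k : ℕ} (s : Fin k → ℕ) (A : Finset (Fin n)) : Prop :=
  ∃ hA : A.card = k,
    let a : Fin k → ℤ := fun i => ((A.orderEmbOfFin hA i : ℕ) : ℤ)
    (∀ (j : ℕ) (hj : j + 1 < k),
      (s ⟨j, Nat.lt_of_succ_lt hj⟩ : ℤ) ≤ a ⟨j + 1, hj⟩ - a ⟨j, Nat.lt_of_succ_lt hj⟩) ∧
    ∀ hk : 0 < k,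
      a ⟨k - 1, Nat.sub_lt hk one_pos⟩ - a ⟨0, hk⟩ ≤ (n : ℤ) - s ⟨k - 1, Nat.sub_lt hk one_pos⟩

/-- The subgraph of the Kneser graph induced on the `s`-stable `k`-sets. -/
def stableKneserGraph (n k : ℕ) (s : Fin k → ℕ) :
    SimpleGraph {A : {A : Finset (Fin n) // A.card = k} | IsStableSet s A.1} :=
  (kneserGraph n k).induce {A | IsStableSet s A.1}

/-- The poset of pairs of disjoint subsets, each containing an `s`-stable `k`-set, ordered by
componentwise inclusion (the order inherited from `Finset (Fin n) × Finset (Fin n)`). -/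
abbrev StablePairPoset (n k : ℕ) (s : Fin k → ℕ) : Type :=
  {p : Finset (Fin n) × Finset (Fin n) //
    Disjoint p.1 p.2 ∧ (∃ S ⊆ p.1, IsStableSet s S) ∧ ∃ S ⊆ p.2, IsStableSet s S}

end

open MeasureTheory Filter Topology Set

/-! ### Realizations and straight-line homotopies -/

section Realization

variable {ι : Type*} [Fintype ι] {K : PreAbstractSimplicialComplex ι}

/-! Both homotopy inverses are explicit. An antitone step function from the unit interval to a
finite poset runs through a chain, so the Lebesgue measures of its level sets are barycentric
coordinates in the order complex (`stepMap`); pointwise comparable families give homotopic maps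
(`stepMap_homotopic`).

A point `w` of the neighborhood complex yields the pair (union of the vertices that are heavy in
`w`, complement of the union of a larger superlevel set), with thresholds moving in time so that
both parts shrink. Conversely, each pair is sent to a stable set chosen in its first part.

One composite stays within a common face of the identity. The other is joined to the identity by the
zigzag `p ≥ a ≤ b ≥ q` of step functions, where `q` only takes values in the chain carrying the
given point. -/

theorem mem_geomRealization_of_support {w : ι → ℝ} {σ : Finset ι} (hσ : σ ∈ K.faces)
    (h0 : ∀ i, 0 ≤ w i) (h1 : ∑ i, w i = 1) (hsupp : ∀ i ∉ σ, w i = 0) :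
    w ∈ geomRealization K :=
  ⟨h0, σ, hσ, hsupp, by
    rw [← h1]; exact Finset.sum_subset (Finset.subset_univ σ) fun i _ hi => hsupp i hi⟩

theorem sum_eq_one_of_mem_geomRealization {w : ι → ℝ} (hw : w ∈ geomRealization K) :
    ∑ i, w i = 1 := by
  obtain ⟨_, σ, _, hsupp, h1⟩ := hw
  rw [← h1]
  exact (Finset.sum_subset (Finset.subset_univ σ) fun i _ hi => hsupp i hi).symm

theorem ne_zero_of_mem_geomRealization {w : ι → ℝ} (hw : w ∈ geomRealization K) : w ≠ 0 := by
  rintro rfl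
  simpa using sum_eq_one_of_mem_geomRealization hw

/-- Two continuous maps to a realization are homotopic along straight segments as soon as, at each
point, their values lie in a common face. -/
theorem homotopic_of_common_face {X : Type*} [TopologicalSpace X]
    (f g : C(X, geomRealization K))
    (h : ∀ x, ∃ σ ∈ K.faces, ∀ i ∉ σ, (f x).1 i = 0 ∧ (g x).1 i = 0) : f.Homotopic g := by
  refine ⟨⟨⟨fun p => ⟨fun i => (1 - (p.1 : ℝ)) * (f p.2).1 i + p.1 * (g p.2).1 i, ?_⟩, ?_⟩, ?_, ?_⟩⟩
  · obtain ⟨σ, hσ, h0⟩ := h p.2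
    refine mem_geomRealization_of_support hσ (fun i => ?_) ?_ fun i hi => ?_
    · exact add_nonneg (mul_nonneg (sub_nonneg.2 p.1.2.2) ((f p.2).2.1 i))
        (mul_nonneg p.1.2.1 ((g p.2).2.1 i))
    · rw [Finset.sum_add_distrib, ← Finset.mul_sum, ← Finset.mul_sum,
        sum_eq_one_of_mem_geomRealization (f p.2).2, sum_eq_one_of_mem_geomRealization (g p.2).2]
      ring
    · simp [h0 i hi]
  · refine Continuous.subtype_mk (continuous_pi fun i => ?_) _
    have hf : Continuous fun p : unitInterval × X => (f p.2).1 i :=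
      (continuous_apply i).comp (continuous_subtype_val.comp (f.continuous.comp continuous_snd))
    have hg : Continuous fun p : unitInterval × X => (g p.2).1 i :=
      (continuous_apply i).comp (continuous_subtype_val.comp (g.continuous.comp continuous_snd))
    have ht : Continuous fun p : unitInterval × X => (p.1 : ℝ) :=
      continuous_subtype_val.comp continuous_fst
    exact ((continuous_const.sub ht).mul hf).add (ht.mul hg)
  · intro x; ext i; simp
  · intro x; ext i; simp

end Realization

/-! ### Step functions as points of the order complex -/

section StepFamily

/-- A family of step functions on the unit interval which, at almost every time, is locally
constant in the parameter. -/
def AELocallyConst {X β : Type*} [TopologicalSpace X] (p : X → unitInterval → β) : Prop :=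
  ∀ x, ∀ᵐ t, ∀ᶠ y in 𝓝 x, p y t = p x t

variable {X Y β γ δ : Type*} [TopologicalSpace X] [TopologicalSpace Y]

theorem AELocallyConst.map₂ {p : X → unitInterval → β} {q : X → unitInterval → γ}
    (hp : AELocallyConst p) (hq : AELocallyConst q) (f : β → γ → δ) :
    AELocallyConst fun x t => f (p x t) (q x t) := fun x => by
  filter_upwards [hp x, hq x] with t h₁ h₂
  filter_upwards [h₁, h₂] with y h₁ h₂
  rw [h₁, h₂]

theorem AELocallyConst.map {p : X → unitInterval → β} (hp : AELocallyConst p) (f : β → γ) :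
    AELocallyConst fun x t => f (p x t) :=
  hp.map₂ hp fun b _ => f b

theorem AELocallyConst.comp {p : X → unitInterval → β} (hp : AELocallyConst p) {f : Y → X}
    (hf : Continuous f) : AELocallyConst fun y => p (f y) := fun y => by
  filter_upwards [hp (f y)] with t h using hf.continuousAt.eventually h

theorem AELocallyConst.of_val {P : β → Prop} {p : X → unitInterval → Subtype P}
    (hp : AELocallyConst fun x t => (p x t).1) : AELocallyConst p := fun x => by
  filter_upwards [hp x] with t h
  filter_upwards [h] with y h using Subtype.ext h

/-- The vertices at which `w` exceeds the proportion `θ` of its maximum. -/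
noncomputable def superlevel {ι : Type*} [Fintype ι] (θ : ℝ) (w : ι → ℝ) : Finset ι :=
  open Classical in Finset.univ.filter fun i => θ * ‖w‖ < w i

theorem mem_superlevel {ι : Type*} [Fintype ι] {θ : ℝ} {w : ι → ℝ} {i : ι} :
    i ∈ superlevel θ w ↔ θ * ‖w‖ < w i := by
  simp [superlevel]

theorem superlevel_anti {ι : Type*} [Fintype ι] {θ η : ℝ} (h : θ ≤ η) (w : ι → ℝ) :
    superlevel η w ⊆ superlevel θ w := fun i hi => by
  rw [mem_superlevel] at hi ⊢
  exact (mul_le_mul_of_nonneg_right h (norm_nonneg w)).trans_lt hi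

theorem superlevel_nonempty {ι : Type*} [Fintype ι] {θ : ℝ} (hθ : θ < 1) {w : ι → ℝ}
    (h0 : ∀ i, 0 ≤ w i) (hw : w ≠ 0) : (superlevel θ w).Nonempty := by
  by_contra h
  rw [Finset.not_nonempty_iff_eq_empty] at h
  have hpos : 0 < ‖w‖ := norm_pos_iff.2 hw
  have hle : ∀ i, w i ≤ θ * ‖w‖ := fun i => by
    by_contra! hi
    simpa [h] using mem_superlevel.2 hi
  -- Only an index is needed, to see that the bound `θ * ‖w‖` is nonnegative.
  obtain ⟨i, -⟩ := Function.ne_iff.1 hw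
  have : ‖w‖ ≤ θ * ‖w‖ := (pi_norm_le_iff_of_nonneg ((h0 i).trans (hle i))).2 fun j => by
    rw [Real.norm_of_nonneg (h0 j)]; exact hle j
  nlinarith

theorem pos_of_mem_superlevel {ι : Type*} [Fintype ι] {θ : ℝ} (hθ : 0 ≤ θ) {w : ι → ℝ} {i : ι}
    (hi : i ∈ superlevel θ w) : 0 < w i :=
  (mul_nonneg hθ (norm_nonneg w)).trans_lt (mem_superlevel.1 hi)

/-- Each coordinate meets the moving threshold at most once, as `θ` is injective and the norm
nonzero. Away from these finitely many times all comparisons are strict, hence stable under small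
perturbation. -/
theorem aeLocallyConst_superlevel {ι : Type*} [Fintype ι] {θ : unitInterval → ℝ}
    (hθ : Function.Injective θ) {y : X → ι → ℝ} (hy : Continuous y) (h0 : ∀ x, y x ≠ 0) :
    AELocallyConst fun x t => superlevel (θ t) (y x) := fun x => by
  have hae : ∀ᵐ t : unitInterval, ∀ i, y x i ≠ θ t * ‖y x‖ := by
    refine ae_all_iff.2 fun i => ?_
    rw [ae_iff]
    refine Set.Subsingleton.measure_zero (fun s hs t ht => hθ ?_) _
    simp only [ne_eq, not_not, Set.mem_ofPred_eq] at hs ht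
    exact mul_right_cancel₀ (norm_ne_zero_iff.2 (h0 x)) (hs.symm.trans ht)
  filter_upwards [hae] with t ht
  have hev : ∀ i, ∀ᶠ z in 𝓝 x, (θ t * ‖y z‖ < y z i ↔ θ t * ‖y x‖ < y x i) := fun i => by
    have hl : Continuous fun z => θ t * ‖y z‖ := continuous_const.mul hy.norm
    have hr : Continuous fun z => y z i := (continuous_apply i).comp hy
    rcases lt_or_gt_of_ne (ht i) with h | h
    · filter_upwards [hr.continuousAt.eventually_lt hl.continuousAt h] with z hz
      simp only [not_lt.2 hz.le, not_lt.2 h.le]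
    · filter_upwards [hl.continuousAt.eventually_lt hr.continuousAt h] with z hz
      simp only [hz, h]
  filter_upwards [eventually_all.2 hev] with z hz
  ext i
  rw [mem_superlevel, mem_superlevel, hz i]

variable {P : Type*}

/-- The distribution of a step function, as a system of weights on its values. -/
noncomputable def stepLaw (p : unitInterval → P) (a : P) : ℝ := (volume : Measure unitInterval).real (p ⁻¹' {a})

theorem stepLaw_eq_zero {p : unitInterval → P} {a : P} (h : ∀ t, p t ≠ a) : stepLaw p a = 0 := by
  have : p ⁻¹' {a} = ∅ := by ext t; simp [h t]
  simp [stepLaw, this]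

variable [PartialOrder P]

theorem Antitone.measurableSet_preimage_singleton {p : unitInterval → P} (hp : Antitone p) (a : P) :
    MeasurableSet (p ⁻¹' {a}) := by
  refine Set.OrdConnected.measurableSet ⟨fun s hs t ht u hu => ?_⟩
  simp only [Set.mem_preimage, Set.mem_singleton_iff] at hs ht ⊢
  exact le_antisymm (hs ▸ hp hu.1) (ht ▸ hp hu.2)

variable [Fintype P]

theorem stepLaw_mem {p : unitInterval → P} (hp : Antitone p) :
    stepLaw p ∈ geomRealization (orderComplex P) := by
  classical
  refine mem_geomRealization_of_support (σ := Finset.univ.filter (· ∈ Set.range p)) ⟨?_, ?_⟩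
    (fun a => measureReal_nonneg) ?_ ?_
  · exact ⟨p 0, Finset.mem_filter.2 ⟨Finset.mem_univ _, 0, rfl⟩⟩
  · intro a ha b hb _
    simp only [Finset.coe_filter, Finset.mem_univ, true_and, Set.mem_ofPred_eq, Set.mem_range]
      at ha hb
    obtain ⟨s, rfl⟩ := ha
    obtain ⟨t, rfl⟩ := hb
    exact (le_total t s).imp (fun h => hp h) fun h => hp h
  · have := sum_measureReal_preimage_singleton (μ := (volume : Measure unitInterval)) Finset.univ
      (f := p) fun a _ => hp.measurableSet_preimage_singleton a
    simpa [stepLaw] using this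
  · intro a ha
    exact stepLaw_eq_zero fun t h => ha (Finset.mem_filter.2 ⟨Finset.mem_univ _, t, h⟩)

/-- Dominated convergence: the indicator of a level set is, at almost every time, locally constant
in the parameter. -/
theorem continuous_stepLaw [FirstCountableTopology X] {p : X → unitInterval → P}
    (hp : ∀ x, Antitone (p x)) (hc : AELocallyConst p) : Continuous fun x => stepLaw (p x) := by
  refine continuous_pi fun a => continuous_iff_continuousAt.2 fun x => ?_
  have hm : ∀ x, MeasurableSet (p x ⁻¹' {a}) := fun x => (hp x).measurableSet_preimage_singleton a
  have heq : ∀ x, stepLaw (p x) a = ∫ t, (p x ⁻¹' {a}).indicator (fun _ => (1 : ℝ)) t := fun x => by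
    rw [stepLaw, integral_indicator_const _ (hm x)]; simp
  simp only [heq]
  refine continuousAt_of_dominated (bound := fun _ => 1)
    (.of_forall fun x => (stronglyMeasurable_const.indicator (hm x)).aestronglyMeasurable)
    (.of_forall fun x => .of_forall fun t => ?_) (integrable_const _) ?_
  · exact (norm_indicator_le_norm_self _ _).trans (by simp)
  · filter_upwards [hc x] with t ht
    refine continuousAt_const.congr (f := fun _ => (p x ⁻¹' {a}).indicator (fun _ => (1 : ℝ)) t) ?_
    filter_upwards [ht] with y hy
    exact Set.indicator_eq_indicator (by rw [Set.mem_preimage, Set.mem_preimage, hy]) rfl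

/-- The continuous map to the order complex given by a family of antitone step functions. -/
noncomputable def stepMap [FirstCountableTopology X] (p : X → unitInterval → P)
    (hp : ∀ x, Antitone (p x)) (hc : AELocallyConst p) :
    C(X, geomRealization (orderComplex P)) :=
  ⟨fun x => ⟨stepLaw (p x), stepLaw_mem (hp x)⟩, (continuous_stepLaw hp hc).subtype_mk _⟩

/-- Comparable families of step functions give homotopic maps. -/
theorem stepMap_homotopic [FirstCountableTopology X] {p q : X → unitInterval → P}
    (hp : ∀ x, Antitone (p x)) (hcp : AELocallyConst p)
    (hq : ∀ x, Antitone (q x)) (hcq : AELocallyConst q) (hle : ∀ x t, p x t ≤ q x t) :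
    (stepMap p hp hcp).Homotopic (stepMap q hq hcq) := by
  classical
  -- The larger `q` comes at early times, which keeps `r` antitone. The factor 2 makes the strict
  -- inequality hold at `t = 1` when the homotopy parameter is 1.
  let r : unitInterval × X → unitInterval → P := fun z t =>
    if (t : ℝ) < 2 * z.1 then q z.2 t else p z.2 t
  have hr : ∀ z, Antitone (r z) := fun z s t hst => by
    have hst' : (s : ℝ) ≤ t := hst
    simp only [r]
    split_ifs with h₁ h₂ h₂
    · exact hq _ hst
    · exact absurd (hst'.trans_lt h₁) h₂
    · exact (hle _ _).trans (hq _ hst)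
    · exact hp _ hst
  have hcr : AELocallyConst r := fun z => by
    have hne : ∀ᵐ t : unitInterval, (t : ℝ) ≠ 2 * z.1 := by
      rw [ae_iff]
      refine Set.Subsingleton.measure_zero (fun s hs t ht => Subtype.ext ?_) _
      simp only [ne_eq, not_not, Set.mem_ofPred_eq] at hs ht
      rw [hs, ht]
    filter_upwards [hcp z.2, hcq z.2, hne] with t h₁ h₂ h₃
    have hz : Continuous fun z : unitInterval × X => 2 * (z.1 : ℝ) := by fun_prop
    have h₄ : ∀ᶠ y : unitInterval × X in 𝓝 z, ((t : ℝ) < 2 * y.1 ↔ (t : ℝ) < 2 * z.1) := by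
      rcases lt_or_gt_of_ne h₃ with h | h
      · filter_upwards [continuousAt_const.eventually_lt hz.continuousAt h] with y hy
        simp only [hy, h]
      · filter_upwards [hz.continuousAt.eventually_lt continuousAt_const h] with y hy
        simp only [not_lt.2 hy.le, not_lt.2 h.le]
    filter_upwards [continuous_snd.continuousAt.eventually h₁,
      continuous_snd.continuousAt.eventually h₂, h₄] with y h₁ h₂ h₄
    simp only [r, h₁, h₂, h₄]
  refine ⟨⟨stepMap r hr hcr, fun x => Subtype.ext ?_, fun x => Subtype.ext ?_⟩⟩
  · have : r (0, x) = p x := by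
      funext t; simp [r, t.2.1]
    simp [stepMap, this]
  · have : r (1, x) = q x := by
      funext t
      have : (t : ℝ) < 2 := t.2.2.trans_lt one_lt_two
      simp [r, this]
    simp [stepMap, this]

end StepFamily

/-! ### The two maps and their composites -/

section DisjointPairs

/-- Pairs of disjoint finite sets, each containing a member of the family `𝓢`. -/
abbrev DisjointPairs {α : Type*} (𝓢 : Finset α → Prop) : Type _ :=
  {p : Finset α × Finset α // Disjoint p.1 p.2 ∧ (∃ S ⊆ p.1, 𝓢 S) ∧ ∃ S ⊆ p.2, 𝓢 S}

theorem DisjointPairs.le_iff {α : Type*} {𝓢 : Finset α → Prop} {p q : DisjointPairs 𝓢} :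
    p ≤ q ↔ p.1.1 ⊆ q.1.1 ∧ p.1.2 ⊆ q.1.2 := Iff.rfl

theorem DisjointPairs.disjoint_of_chain {α : Type*} {𝓢 : Finset α → Prop}
    {σ : Finset (DisjointPairs 𝓢)} (hσ : σ ∈ (orderComplex (DisjointPairs 𝓢)).faces)
    {p q : DisjointPairs 𝓢} (hp : p ∈ σ) (hq : q ∈ σ) : Disjoint p.1.1 q.1.2 := by
  rcases hσ.2.total hp hq with h | h
  · exact q.2.1.mono_left h.1
  · exact p.2.1.mono_right h.2

/-- The high threshold at time `t`. -/
noncomputable def hiLevel (t : unitInterval) : ℝ := (2 + t) / 4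

/-- The low threshold at time `t`. -/
noncomputable def loLevel (t : unitInterval) : ℝ := (2 - t) / 4

theorem hiLevel_injective : Function.Injective hiLevel := fun s t h => by
  apply Subtype.ext; simp only [hiLevel] at h; linarith

theorem loLevel_injective : Function.Injective loLevel := fun s t h => by
  apply Subtype.ext; simp only [loLevel] at h; linarith

theorem hiLevel_mono : Monotone hiLevel := fun s t h => by
  have : (s : ℝ) ≤ t := h
  simp only [hiLevel]; linarith

theorem loLevel_anti : Antitone loLevel := fun s t h => by
  have : (s : ℝ) ≤ t := h
  simp only [loLevel]; linarith

theorem hiLevel_lt_one (t : unitInterval) : hiLevel t < 1 := by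
  have := t.2.2; simp only [hiLevel]; linarith

theorem hiLevel_nonneg (t : unitInterval) : 0 ≤ hiLevel t := by
  have := t.2.1; simp only [hiLevel]; linarith

theorem loLevel_nonneg (t : unitInterval) : 0 ≤ loLevel t := by
  have := t.2.2; simp only [loLevel]; linarith

theorem loLevel_le_hiLevel (t : unitInterval) : loLevel t ≤ hiLevel t := by
  have := t.2.1; simp only [loLevel, hiLevel]; linarith

theorem hiSuperlevel_nonempty {ι : Type*} [Fintype ι] {K : PreAbstractSimplicialComplex ι}
    (w : geomRealization K) (t : unitInterval) : (superlevel (hiLevel t) w.1).Nonempty :=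
  superlevel_nonempty (hiLevel_lt_one t) w.2.1 (ne_zero_of_mem_geomRealization w.2)

theorem superlevel_subset_face {ι : Type*} [Fintype ι] {θ : ℝ} (hθ : 0 ≤ θ) {w : ι → ℝ}
    {σ : Finset ι} (hσ : ∀ i ∉ σ, w i = 0) : superlevel θ w ⊆ σ := fun i hi => by
  by_contra h
  exact (pos_of_mem_superlevel hθ hi).ne' (hσ i h)

theorem aeLocallyConst_hiSuperlevel {ι : Type*} [Fintype ι]
    (K : PreAbstractSimplicialComplex ι) :
    AELocallyConst fun (w : geomRealization K) t => superlevel (hiLevel t) w.1 :=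
  aeLocallyConst_superlevel hiLevel_injective continuous_subtype_val
    fun w => ne_zero_of_mem_geomRealization w.2

theorem aeLocallyConst_loSuperlevel {ι : Type*} [Fintype ι]
    (K : PreAbstractSimplicialComplex ι) :
    AELocallyConst fun (w : geomRealization K) t => superlevel (loLevel t) w.1 :=
  aeLocallyConst_superlevel loLevel_injective continuous_subtype_val
    fun w => ne_zero_of_mem_geomRealization w.2

theorem biUnion_superlevel_anti {ι α : Type*} [Fintype ι] [DecidableEq α] (f : ι → Finset α) {θ η : ℝ} (h : θ ≤ η)
    (w : ι → ℝ) : (superlevel η w).biUnion f ⊆ (superlevel θ w).biUnion f :=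
  Finset.biUnion_subset_biUnion_of_subset_left _ (superlevel_anti h w)

variable {α V : Type*} [Fintype α] [DecidableEq α] [Fintype V] {G : SimpleGraph V}
  {𝓢 : Finset α → Prop} [Fintype (DisjointPairs 𝓢)] {c : V → Finset α}

/-- The step function with values in the poset of pairs attached to a point of the neighborhood
complex. -/
noncomputable def levelPair (hG : ∀ u v, G.Adj u v ↔ Disjoint (c u) (c v)) (hc : ∀ v, 𝓢 (c v))
    (w : geomRealization (neighborhoodComplex G)) (t : unitInterval) : DisjointPairs 𝓢 :=
  ⟨((superlevel (hiLevel t) w.1).biUnion c, ((superlevel (loLevel t) w.1).biUnion c)ᶜ), by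
    refine ⟨?_, ?_, ?_⟩
    · exact (disjoint_compl_right (a := (superlevel (loLevel t) w.1).biUnion c)).mono_left
        (biUnion_superlevel_anti c (loLevel_le_hiLevel t) _)
    · obtain ⟨u, hu⟩ := hiSuperlevel_nonempty w t
      exact ⟨c u, Finset.subset_biUnion_of_mem c hu, hc u⟩
    -- A common neighbor of the carrying face avoids the whole union, so it lies in the complement.
    · obtain ⟨_, σ, ⟨_, v, hv⟩, h0, _⟩ := w.2
      refine ⟨c v, le_compl_iff_disjoint_right.2 ?_, hc v⟩
      exact (Finset.disjoint_biUnion_right _ _ _).2 fun u hu =>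
        (hG v u).1 (hv u (superlevel_subset_face (loLevel_nonneg t) h0 hu))⟩

theorem levelPair_anti (hG : ∀ u v, G.Adj u v ↔ Disjoint (c u) (c v)) (hc : ∀ v, 𝓢 (c v))
    (w : geomRealization (neighborhoodComplex G)) : Antitone (levelPair hG hc w) := fun _ _ h =>
  ⟨biUnion_superlevel_anti c (hiLevel_mono h) _,
    compl_le_compl (biUnion_superlevel_anti c (loLevel_anti h) _)⟩

theorem aeLocallyConst_levelPair (hG : ∀ u v, G.Adj u v ↔ Disjoint (c u) (c v))
    (hc : ∀ v, 𝓢 (c v)) : AELocallyConst (levelPair hG hc) :=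
  .of_val ((aeLocallyConst_hiSuperlevel _).map₂ (aeLocallyConst_loSuperlevel _)
    fun S T => (S.biUnion c, (T.biUnion c)ᶜ))

/-- The map from the neighborhood complex to the order complex of the poset of pairs. -/
noncomputable def toOrderComplex (hG : ∀ u v, G.Adj u v ↔ Disjoint (c u) (c v)) (hc : ∀ v, 𝓢 (c v)) :
    C(geomRealization (neighborhoodComplex G), geomRealization (orderComplex (DisjointPairs 𝓢))) :=
  stepMap (levelPair hG hc) (levelPair_anti hG hc) (aeLocallyConst_levelPair hG hc)

/-- The weights induced on the vertices of the graph by a vertex choice `f`. -/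
noncomputable def pushWeights {ι κ : Type*} [Fintype ι] (f : ι → κ) (x : ι → ℝ) (v : κ) : ℝ :=
  open Classical in ∑ i, if f i = v then x i else 0

theorem pushWeights_eq_zero {ι κ : Type*} [Fintype ι] {f : ι → κ} {x : ι → ℝ} {v : κ}
    (h : ∀ i, f i = v → x i = 0) : pushWeights f x v = 0 :=
  Finset.sum_eq_zero fun i _ => by
    split_ifs with hi
    exacts [h i hi, rfl]

theorem pushWeights_mem {f : DisjointPairs 𝓢 → V} (hf : ∀ p, c (f p) ⊆ p.1.1)
    (hG : ∀ u v, G.Adj u v ↔ Disjoint (c u) (c v)) (hc : ∀ S, 𝓢 S → ∃ v, c v = S)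
    {x : DisjointPairs 𝓢 → ℝ} (hx : x ∈ geomRealization (orderComplex (DisjointPairs 𝓢))) :
    pushWeights f x ∈ geomRealization (neighborhoodComplex G) := by
  classical
  obtain ⟨h0, σ, hσ, hsupp, -⟩ := id hx
  refine mem_geomRealization_of_support (σ := σ.image f) ⟨hσ.1.image f, ?_⟩ (fun v => ?_) ?_
    fun v hv => pushWeights_eq_zero fun p hp => hsupp p fun hpσ =>
      hv (Finset.mem_image.2 ⟨p, hpσ, hp⟩)
  -- Any member of the chain will do: a stable set in its second part is a common neighbor.
  · obtain ⟨m, hm⟩ := hσ.1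
    obtain ⟨m, hm, hmax⟩ : ∃ m ∈ σ, ∀ p ∈ σ, Disjoint p.1.1 m.1.2 :=
      ⟨m, hm, fun p hp => DisjointPairs.disjoint_of_chain hσ hp hm⟩
    obtain ⟨S, hSm, hS⟩ := m.2.2.2
    obtain ⟨v, rfl⟩ := hc S hS
    refine ⟨v, fun u hu => ?_⟩
    obtain ⟨p, hp, rfl⟩ := Finset.mem_image.1 hu
    exact (hG _ _).2 ((hmax p hp).mono (hf p) hSm).symm
  · exact Finset.sum_nonneg fun p _ => by split_ifs; exacts [h0 p, le_rfl]
  · simp only [pushWeights]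
    rw [Finset.sum_comm, ← sum_eq_one_of_mem_geomRealization hx]
    exact Finset.sum_congr rfl fun p _ => by simp

/-- The simplicial map sending a pair to a chosen vertex below its first component. -/
noncomputable def toNeighborhoodComplex {f : DisjointPairs 𝓢 → V} (hf : ∀ p, c (f p) ⊆ p.1.1)
    (hG : ∀ u v, G.Adj u v ↔ Disjoint (c u) (c v)) (hc : ∀ S, 𝓢 S → ∃ v, c v = S) :
    C(geomRealization (orderComplex (DisjointPairs 𝓢)), geomRealization (neighborhoodComplex G)) :=
  ⟨fun x => ⟨pushWeights f x.1, pushWeights_mem hf hG hc x.2⟩, by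
    refine Continuous.subtype_mk (continuous_pi fun v => continuous_finsetSum _ fun p _ => ?_) _
    split_ifs
    · exact (continuous_apply p).comp continuous_subtype_val
    · exact continuous_const⟩

theorem exists_of_mem_superlevel_pushWeights {ι κ : Type*} [Fintype ι] [Fintype κ] {f : ι → κ}
    {x : ι → ℝ} {σ : Finset ι} (hσ : ∀ i ∉ σ, x i = 0) {θ : ℝ} (hθ : 0 ≤ θ) {v : κ}
    (hv : v ∈ superlevel θ (pushWeights f x)) : ∃ i ∈ σ, f i = v := by
  by_contra! h
  exact (pos_of_mem_superlevel hθ hv).ne'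
    (pushWeights_eq_zero fun i hi => hσ i fun hi' => h i hi' hi)

theorem toNeighborhoodComplex_comp_homotopic {f : DisjointPairs 𝓢 → V}
    (hf : ∀ p, c (f p) ⊆ p.1.1) (hG : ∀ u v, G.Adj u v ↔ Disjoint (c u) (c v))
    (hc : ∀ S, 𝓢 S → ∃ v, c v = S) (hc' : ∀ v, 𝓢 (c v)) :
    ((toNeighborhoodComplex hf hG hc).comp (toOrderComplex hG hc')).Homotopic
      (ContinuousMap.id _) := by
  classical
  refine homotopic_of_common_face _ _ fun w => ?_
  obtain ⟨_, σ, ⟨hne, v, hv⟩, h0, _⟩ := w.2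
  -- The chosen vertices lie inside unions of sets from `σ`, so a common neighbor `v` of `σ` is
  -- adjacent to them too.
  refine ⟨σ ∪ Finset.univ.filter (fun u => ∃ t, f (levelPair hG hc' w t) = u),
    ⟨hne.mono Finset.subset_union_left, v, fun u hu => ?_⟩, fun u hu => ?_⟩
  · rcases Finset.mem_union.1 hu with hu | hu
    · exact hv u hu
    · obtain ⟨t, rfl⟩ := (Finset.mem_filter.1 hu).2
      refine (hG _ _).2 (Disjoint.mono_right (hf _) ?_)
      exact (Finset.disjoint_biUnion_right _ _ _).2 fun u hu =>
        (hG v u).1 (hv u (superlevel_subset_face (hiLevel_nonneg t) h0 hu))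
  · simp only [Finset.mem_union, Finset.mem_filter, Finset.mem_univ, true_and, not_or,
      not_exists] at hu
    refine ⟨pushWeights_eq_zero fun p hp => stepLaw_eq_zero fun t ht => hu.2 t ?_, h0 u hu.1⟩
    rw [ht, hp]

/-- The largest pair, at time `t`, in the superlevel set of a point of the order complex. -/
noncomputable def supPair (x : geomRealization (orderComplex (DisjointPairs 𝓢))) (t : unitInterval) :
    Finset α × Finset α :=
  ((superlevel (hiLevel t) x.1).biUnion (·.1.1), (superlevel (hiLevel t) x.1).biUnion (·.1.2))

theorem supPair_anti (x : geomRealization (orderComplex (DisjointPairs 𝓢))) :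
    Antitone (supPair x) := fun _ _ h =>
  ⟨biUnion_superlevel_anti _ (hiLevel_mono h) _, biUnion_superlevel_anti _ (hiLevel_mono h) _⟩

theorem aeLocallyConst_supPair :
    AELocallyConst fun (x : geomRealization (orderComplex (DisjointPairs 𝓢))) t => supPair x t :=
  AELocallyConst.map (aeLocallyConst_hiSuperlevel (orderComplex (DisjointPairs 𝓢)))
    fun S => (S.biUnion fun p => p.1.1, S.biUnion fun p => p.1.2)

/-- The superlevel set is a nonempty finite chain, so its greatest element has the two unions as
components. -/
theorem exists_supPair_eq {x : geomRealization (orderComplex (DisjointPairs 𝓢))}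
    {σ : Finset (DisjointPairs 𝓢)} (hσ : σ ∈ (orderComplex (DisjointPairs 𝓢)).faces)
    (hsupp : ∀ p ∉ σ, x.1 p = 0) (t : unitInterval) : ∃ p ∈ σ, p.1 = supPair x t := by
  have hsub := superlevel_subset_face (hiLevel_nonneg t) hsupp
  obtain ⟨m, hm, hmax⟩ := (superlevel (hiLevel t) x.1).exists_maximal (hiSuperlevel_nonempty x t)
  have hle : ∀ p ∈ superlevel (hiLevel t) x.1, p ≤ m := fun p hp =>
    (hσ.2.total (hsub hp) (hsub hm)).elim id fun h => hmax hp h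
  have h₁ : m.1.1 = (superlevel (hiLevel t) x.1).biUnion fun p => p.1.1 :=
    subset_antisymm (Finset.subset_biUnion_of_mem (fun p : DisjointPairs 𝓢 => p.1.1) hm)
      (Finset.biUnion_subset.2 fun p hp => (DisjointPairs.le_iff.1 (hle p hp)).1)
  have h₂ : m.1.2 = (superlevel (hiLevel t) x.1).biUnion fun p => p.1.2 :=
    subset_antisymm (Finset.subset_biUnion_of_mem (fun p : DisjointPairs 𝓢 => p.1.2) hm)
      (Finset.biUnion_subset.2 fun p hp => (DisjointPairs.le_iff.1 (hle p hp)).2)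
  exact ⟨m, hsub hm, Prod.ext h₁ h₂⟩

theorem toOrderComplex_comp_homotopic {f : DisjointPairs 𝓢 → V}
    (hf : ∀ p, c (f p) ⊆ p.1.1) (hG : ∀ u v, G.Adj u v ↔ Disjoint (c u) (c v))
    (hc : ∀ S, 𝓢 S → ∃ v, c v = S) (hc' : ∀ v, 𝓢 (c v)) :
    ((toOrderComplex hG hc').comp (toNeighborhoodComplex hf hG hc)).Homotopic
      (ContinuousMap.id _) := by
  classical
  set ψ := toNeighborhoodComplex hf hG hc
  let p : geomRealization (orderComplex (DisjointPairs 𝓢)) → unitInterval → DisjointPairs 𝓢 :=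
    fun x => levelPair hG hc' (ψ x)
  have hp : ∀ x, Antitone (p x) := fun x => levelPair_anti hG hc' (ψ x)
  have hpc : AELocallyConst p := (aeLocallyConst_levelPair hG hc').comp ψ.continuous
  have hq : ∀ (x : geomRealization (orderComplex (DisjointPairs 𝓢))) (t : unitInterval),
      ∃ q : DisjointPairs 𝓢, q.1 = supPair x t := fun x t => by
    obtain ⟨_, σ, hσ, hsupp, _⟩ := x.2
    obtain ⟨q, -, hq⟩ := exists_supPair_eq hσ hsupp t
    exact ⟨q, hq⟩
  choose q hq using hq
  have hqa : ∀ x, Antitone (q x) := fun x s t h => by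
    change (q x t).1 ≤ (q x s).1
    rw [hq, hq]; exact supPair_anti x h
  have hqc : AELocallyConst q := AELocallyConst.of_val (by
    simp only [hq]
    exact aeLocallyConst_supPair)
  -- The left side is covered by first parts of pairs in the chain carrying `x`, and the right side
  -- is a second part from that chain.
  have hdisj : ∀ x t θ, 0 ≤ θ →
      Disjoint ((superlevel θ (ψ x).1).biUnion c) (q x t).1.2 := fun x t θ hθ => by
    obtain ⟨_, σ, hσ, hsupp, _⟩ := x.2
    obtain ⟨r, hr, hrq⟩ := exists_supPair_eq hσ hsupp t
    rw [hq, ← hrq]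
    refine (Finset.disjoint_biUnion_left _ _ _).2 fun u hu => ?_
    obtain ⟨i, hi, rfl⟩ := exists_of_mem_superlevel_pushWeights hsupp hθ hu
    exact (DisjointPairs.disjoint_of_chain hσ hi hr).mono_left (hf i)
  -- `p` and `q` need not be comparable; `a` mixes their parts, and `b` enlarges its first part to
  -- lie above both `a` and `q`.
  let a : geomRealization (orderComplex (DisjointPairs 𝓢)) → unitInterval → DisjointPairs 𝓢 :=
    fun x t => ⟨((p x t).1.1, (q x t).1.2), hdisj x t _ (hiLevel_nonneg t), (p x t).2.2.1,
      (q x t).2.2.2⟩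
  let b : geomRealization (orderComplex (DisjointPairs 𝓢)) → unitInterval → DisjointPairs 𝓢 :=
    fun x t => ⟨((p x t).1.1 ∪ (q x t).1.1, (q x t).1.2),
      Finset.disjoint_union_left.2 ⟨hdisj x t _ (hiLevel_nonneg t), (q x t).2.1⟩,
      (q x t).2.2.1.imp fun S hS => ⟨hS.1.trans Finset.subset_union_right, hS.2⟩, (q x t).2.2.2⟩
  have ha : ∀ x, Antitone (a x) := fun x s t h => ⟨(hp x h).1, (hqa x h).2⟩
  have hac : AELocallyConst a :=
    AELocallyConst.of_val (AELocallyConst.map₂ hpc hqc fun p q => (p.1.1, q.1.2))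
  have hb : ∀ x, Antitone (b x) := fun x s t h =>
    ⟨Finset.union_subset_union (hp x h).1 (hqa x h).1, (hqa x h).2⟩
  have hbc : AELocallyConst b :=
    AELocallyConst.of_val (AELocallyConst.map₂ hpc hqc fun p q => (p.1.1 ∪ q.1.1, q.1.2))
  have hap : (stepMap a ha hac).Homotopic (stepMap p hp hpc) :=
    stepMap_homotopic _ _ _ _ fun x t => ⟨le_rfl,
      le_compl_iff_disjoint_left.2 (hdisj x t _ (loLevel_nonneg t))⟩
  have hab : (stepMap a ha hac).Homotopic (stepMap b hb hbc) :=
    stepMap_homotopic _ _ _ _ fun x t => ⟨Finset.subset_union_left, le_rfl⟩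
  have hqb : (stepMap q hqa hqc).Homotopic (stepMap b hb hbc) :=
    stepMap_homotopic _ _ _ _ fun x t => ⟨Finset.subset_union_right, le_rfl⟩
  have hid : (stepMap q hqa hqc).Homotopic (ContinuousMap.id _) := by
    refine homotopic_of_common_face _ _ fun x => ?_
    obtain ⟨_, σ, hσ, hsupp, _⟩ := x.2
    refine ⟨σ, hσ, fun r hr => ⟨stepLaw_eq_zero fun t ht => hr ?_, hsupp r hr⟩⟩
    obtain ⟨r', hr', h⟩ := exists_supPair_eq hσ hsupp t
    rwa [← ht, Subtype.ext ((hq x t).trans h.symm)]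
  exact (hap.symm.trans hab).trans (hqb.symm.trans hid)

/-- For a graph whose vertices are represented by sets, adjacency being disjointness, the
neighborhood complex is homotopy equivalent to the order complex of the poset of pairs of disjoint
sets each containing a representing set. -/
theorem nonempty_homotopyEquiv_neighborhoodComplex
    (hG : ∀ u v, G.Adj u v ↔ Disjoint (c u) (c v)) (hc : ∀ S, 𝓢 S ↔ ∃ v, c v = S) :
    Nonempty (ContinuousMap.HomotopyEquiv
      (geomRealization (neighborhoodComplex G))
      (geomRealization (orderComplex (DisjointPairs 𝓢)))) := by
  have hc' : ∀ v, 𝓢 (c v) := fun v => (hc _).2 ⟨v, rfl⟩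
  have hf : ∀ p : DisjointPairs 𝓢, ∃ v, c v ⊆ p.1.1 := fun p => by
    obtain ⟨S, hS, h⟩ := p.2.2.1
    obtain ⟨v, rfl⟩ := (hc S).1 h
    exact ⟨v, hS⟩
  choose f hf using hf
  exact ⟨⟨toOrderComplex hG hc', toNeighborhoodComplex hf hG fun S => (hc S).1,
    toNeighborhoodComplex_comp_homotopic hf hG _ hc', toOrderComplex_comp_homotopic hf hG _ hc'⟩⟩

end DisjointPairs

/-! ### Stable Kneser graphs -/

theorem stableKneserGraph_adj_iff {n k : ℕ} (hk : 0 < k) (s : Fin k → ℕ)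
    (u v : {A : {A : Finset (Fin n) // A.card = k} | IsStableSet s A.1}) :
    (stableKneserGraph n k s).Adj u v ↔ Disjoint u.1.1 v.1.1 := by
  refine ⟨fun h => h.2, fun h => ⟨fun huv => ?_, h⟩⟩
  have hdis : Disjoint u.1.1 u.1.1 := by
    conv_rhs => rw [show u.1 = v.1 from huv]
    exact h
  have := u.1.2
  rw [(Finset.disjoint_self_iff_empty _).1 hdis, Finset.card_empty] at this
  exact hk.ne this

theorem mainTheorem6 (n k : ℕ) (hn : 0 < n) (hk : 0 < k) (s : Fin k → ℕ) (hs : ∀ i, 0 < s i) :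
    Nonempty (ContinuousMap.HomotopyEquiv
      (geomRealization (neighborhoodComplex (stableKneserGraph n k s)))
      (geomRealization (orderComplex (StablePairPoset n k s)))) := by
  have := Fintype.ofFinite {A : {A : Finset (Fin n) // A.card = k} | IsStableSet s A.1}
  have : Fintype (DisjointPairs (IsStableSet (n := n) s)) := Fintype.ofFinite _
  exact nonempty_homotopyEquiv_neighborhoodComplex (𝓢 := IsStableSet s) (c := fun v => v.1.1)
    (stableKneserGraph_adj_iff hk s)
    fun S => ⟨fun h => ⟨⟨⟨S, h.1⟩, h⟩, rfl⟩, by rintro ⟨v, rfl⟩; exact v.2⟩
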